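/- Let $X$ be a finite set and let $(X,\{R_i\}_{i=0}^3)$ be a symmetric association scheme with $3$ classes, i.e. $R_0,\dots,R_3$ are nonempty symmetric relations partitioning $X\times X$, $R_0$ is the identity relation, and for all $i,j,k$ and $(x,y)\in R_k$ the number of $z$ with $(x,z)\in R_i$, $(z,y)\in R_j$ depends only on $i,j,k$. Let $E_0=\frac1{|X|}J,E_1,E_2,E_3$ be an ordering of the primitive idempotents of its Bose--Mesner algebra, and define the Krein numbers $q_{ij}^k$ by $E_i\circ E_j=\frac1{|X|}\sum_{k=0}^3 q_{ij}^kE_k$, where $\circ$ is the entrywise product. Put $a_i^*=q_{1,i}^i$, $b_i^*=q_{1,i+1}^i$ ($i<3$), $c_i^*=q_{1,i-1}^i$ ($i>0$), $b_3^*=c_0^*=0$. Assume that the scheme is $Q$-polynomial with respect to this ordering, i.e. for each $i$ there is a polynomial $v_i^*$ of degree $i$ such that $|X|E_i=v_i^*(|X|E_1)$ entrywise. Assume further that it is $Q$-antipodal with equivalence relation $R_0\cup R_2$, i.e. $b_j^*=c_{3-j}^*$ for all $j\in\{0,1,2,3\}$ with $j\neq1$, $R_0\cup R_2$ is an equivalence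 relation, and its adjacency matrix is a scalar multiple of $E_0+E_3$. Then the following are equivalent. 1. The scheme is triply regular: for all $i,j,k,l,m,n\in\{0,1,2,3\}$ and all $x,y,z\in X$ with $(x,y)\in R_i$, $(y,z)\in R_j$, $(z,x)\in R_k$, the number $|\{w\in X:(x,w)\in R_l,\ (y,w)\in R_m,\ (z,w)\in R_n\}|$ depends only on $i,j,k,l,m,n$ and not on $x,y,z$. 2. $a_1^*=0$. -/

import Mathlib

open scoped Matrix

/-- A symmetric association scheme with `d` classes on a finite set `X`.  The partition of
`X × X` into the `d + 1` nonempty relations `R₀, …, R_d` is recorded by the map sending `(x, y)`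
to the index `rel x y` of the unique relation that contains it. -/
structure AssocScheme (X : Type*) [Fintype X] (d : ℕ) where
  rel : X → X → Fin (d + 1)
  rel_nonempty : ∀ i, ∃ x y, rel x y = i
  rel_eq_zero_iff : ∀ x y, rel x y = 0 ↔ x = y
  rel_symm : ∀ x y, rel x y = rel y x
  exists_intersection_number : ∀ i j k, ∃ p : ℕ, ∀ x y, rel x y = k →
    (Finset.univ.filter fun z => rel x z = i ∧ rel z y = j).card = p

namespace AssocScheme

variable {X : Type*} [Fintype X] {d : ℕ}

/-- The adjacency matrix of the relation `R_i`. -/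
def adj (S : AssocScheme X d) (i : Fin (d + 1)) : Matrix X X ℝ :=
  Matrix.of fun x y => if S.rel x y = i then 1 else 0

/-- The Bose–Mesner algebra, as the real span of the adjacency matrices. -/
def boseMesner (S : AssocScheme X d) : Submodule ℝ (Matrix X X ℝ) :=
  Submodule.span ℝ (Set.range S.adj)

/-- `E₀, …, E_d` is an ordering of the primitive idempotents of the Bose–Mesner algebra, with
`E₀ = |X|⁻¹ J`.  (The algebra has dimension `d + 1`, so `d + 1` nonzero pairwise orthogonal
idempotents in it are exactly its primitive idempotents.) -/
structure IsPrimitiveIdempotents [DecidableEq X] (S : AssocScheme X d)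
    (E : Fin (d + 1) → Matrix X X ℝ) : Prop where
  mem : ∀ i, E i ∈ S.boseMesner
  ne_zero : ∀ i, E i ≠ 0
  mul_self : ∀ i, E i * E i = E i
  mul_ne : ∀ i j, i ≠ j → E i * E j = 0
  sum_eq_one : ∑ i, E i = 1
  zero_eq : E 0 = (Fintype.card X : ℝ)⁻¹ • Matrix.of fun _ _ => 1

/-- The Krein number `q_{ij}^k`, that is, the coefficient in
`E_i ∘ E_j = |X|⁻¹ ∑ k, q_{ij}^k E_k` (entrywise product); see `hadamard_eq_sum_krein`. -/
noncomputable def krein (E : Fin (d + 1) → Matrix X X ℝ) (i j k : Fin (d + 1)) : ℝ :=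
  Fintype.card X * ((E i ⊙ E j) * E k).trace / (E k).trace

/-- `a_i^* = q_{1,i}^i`. -/
noncomputable def aStar (E : Fin (d + 1) → Matrix X X ℝ) (i : Fin (d + 1)) : ℝ :=
  krein E 1 i i

/-- `b_i^* = q_{1,i+1}^i` for `i < d`, and `b_d^* = 0`. -/
noncomputable def bStar (E : Fin (d + 1) → Matrix X X ℝ) (i : Fin (d + 1)) : ℝ :=
  if h : (i : ℕ) < d then krein E 1 ⟨i + 1, by omega⟩ i else 0

/-- `c_i^* = q_{1,i-1}^i` for `0 < i`, and `c_0^* = 0`. -/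
noncomputable def cStar (E : Fin (d + 1) → Matrix X X ℝ) (i : Fin (d + 1)) : ℝ :=
  if 0 < (i : ℕ) then krein E 1 ⟨i - 1, by omega⟩ i else 0

/-- The scheme is `Q`-polynomial with respect to the ordering `E₀, …, E_d` of its primitive
idempotents: for each `i` there is a polynomial `v_i^*` of degree `i` such that
`|X| E_i = v_i^*(|X| E_1)`, applied entrywise. -/
def IsQPolynomial [DecidableEq X] (S : AssocScheme X d)
    (E : Fin (d + 1) → Matrix X X ℝ) : Prop :=
  S.IsPrimitiveIdempotents E ∧
    ∀ i : Fin (d + 1), ∃ p : Polynomial ℝ, p.degree = ((i : ℕ) : WithBot ℕ) ∧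
      ∀ x y, (Fintype.card X : ℝ) * E i x y = p.eval ((Fintype.card X : ℝ) * E 1 x y)

/-- The `Q`-antipodality condition on the dual intersection array: `b_j^* = c_{d-j}^*` for all
`j` except possibly `j = ⌊d/2⌋`. -/
def IsQAntipodal (E : Fin (d + 1) → Matrix X X ℝ) : Prop :=
  ∀ j : Fin (d + 1), (j : ℕ) ≠ d / 2 → bStar E j = cStar E j.rev

/-- `⋃ i ∈ I, R_i` is the equivalence relation belonging to `Q`-antipodality: it is an
equivalence relation, and its matrix is a multiple of `E_0 + E_d`. -/
def IsQAntipodalRelation (S : AssocScheme X d) (E : Fin (d + 1) → Matrix X X ℝ)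
    (I : Finset (Fin (d + 1))) : Prop :=
  Equivalence (fun x y => S.rel x y ∈ I) ∧
    ∃ c : ℝ, ∑ i ∈ I, S.adj i = c • (E 0 + E (Fin.last d))

/-- Triple regularity: for `(x, y) ∈ R_i`, `(y, z) ∈ R_j`, `(z, x) ∈ R_k`, the number
`|R_l(x) ∩ R_m(y) ∩ R_n(z)|` depends only on `i, j, k, l, m, n`. -/
def IsTriplyRegular (S : AssocScheme X d) : Prop :=
  ∀ i j k l m n : Fin (d + 1), ∃ p : ℕ, ∀ x y z : X,
    S.rel x y = i → S.rel y z = j → S.rel z x = k →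
      (Finset.univ.filter fun w => S.rel x w = l ∧ S.rel y w = m ∧ S.rel z w = n).card = p

theorem hadamard_mem_boseMesner (S : AssocScheme X d) {M N : Matrix X X ℝ}
    (hM : M ∈ S.boseMesner) (hN : N ∈ S.boseMesner) : M ⊙ N ∈ S.boseMesner := by
  unfold boseMesner at hM hN
  induction hM using Submodule.span_induction with
  | mem M h =>
    obtain ⟨i, rfl⟩ := h
    induction hN using Submodule.span_induction with
    | mem N h =>
      obtain ⟨j, rfl⟩ := h
      by_cases hij : i = j
      · subst hij
        have : S.adj i ⊙ S.adj i = S.adj i := by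
          ext x y; simp [adj, Matrix.hadamard]
        rw [this]
        exact Submodule.subset_span ⟨i, rfl⟩
      · have : S.adj i ⊙ S.adj j = 0 := by
          ext x y
          simp only [adj, Matrix.hadamard, Matrix.of_apply, Matrix.zero_apply]
          split_ifs <;> simp_all
        rw [this]
        exact Submodule.zero_mem _
    | zero => simp
    | add M N _ _ h1 h2 => rw [Matrix.hadamard_add]; exact Submodule.add_mem _ h1 h2
    | smul c M _ h => rw [Matrix.hadamard_smul]; exact Submodule.smul_mem _ _ h
  | zero => simp
  | add M N _ _ h1 h2 => rw [Matrix.add_hadamard]; exact Submodule.add_mem _ h1 h2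
  | smul c M _ h => rw [Matrix.smul_hadamard]; exact Submodule.smul_mem _ _ h

theorem IsPrimitiveIdempotents.sum_smul_mul [DecidableEq X] {S : AssocScheme X d}
    {E : Fin (d + 1) → Matrix X X ℝ} (hE : S.IsPrimitiveIdempotents E)
    (g : Fin (d + 1) → ℝ) (k : Fin (d + 1)) : (∑ i, g i • E i) * E k = g k • E k := by
  rw [Finset.sum_mul, Finset.sum_eq_single k]
  · rw [smul_mul_assoc, hE.mul_self]
  · intro i _ hi
    rw [smul_mul_assoc, hE.mul_ne i k hi, smul_zero]
  · simp

theorem IsPrimitiveIdempotents.span_eq [DecidableEq X] {S : AssocScheme X d}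
    {E : Fin (d + 1) → Matrix X X ℝ} (hE : S.IsPrimitiveIdempotents E) :
    Submodule.span ℝ (Set.range E) = S.boseMesner := by
  have hli : LinearIndependent ℝ E := by
    rw [Fintype.linearIndependent_iff]
    intro g hg k
    have h := hE.sum_smul_mul g k
    rw [hg, zero_mul] at h
    exact (smul_eq_zero.mp h.symm).resolve_right (hE.ne_zero k)
  apply Submodule.eq_of_le_of_finrank_le
  · rw [Submodule.span_le]
    rintro _ ⟨i, rfl⟩
    exact hE.mem i
  · rw [finrank_span_eq_card hli]
    exact finrank_range_le_card S.adj

theorem IsPrimitiveIdempotents.trace_ne_zero [DecidableEq X] {S : AssocScheme X d}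
    {E : Fin (d + 1) → Matrix X X ℝ} (hE : S.IsPrimitiveIdempotents E) (k : Fin (d + 1)) :
    (E k).trace ≠ 0 := by
  have hsymm : (E k)ᵀ = E k := by
    have h := hE.mem k
    unfold boseMesner at h
    generalize E k = M at h
    induction h using Submodule.span_induction with
    | mem M h =>
      obtain ⟨i, rfl⟩ := h
      ext x y
      simp [adj, S.rel_symm x y]
    | zero => simp
    | add M N _ _ h1 h2 => rw [Matrix.transpose_add, h1, h2]
    | smul c M _ h => rw [Matrix.transpose_smul, h]
  intro h0
  apply hE.ne_zero k
  rw [← Matrix.trace_conjTranspose_mul_self_eq_zero_iff,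
    Matrix.conjTranspose_eq_transpose_of_trivial, hsymm, hE.mul_self, h0]

/-- The numbers `krein E i j k` are the Krein numbers of the scheme. -/
theorem IsPrimitiveIdempotents.hadamard_eq_sum_krein [DecidableEq X] {S : AssocScheme X d}
    {E : Fin (d + 1) → Matrix X X ℝ} (hE : S.IsPrimitiveIdempotents E) (i j : Fin (d + 1)) :
    E i ⊙ E j = (Fintype.card X : ℝ)⁻¹ • ∑ k, krein E i j k • E k := by
  have hX : (Fintype.card X : ℝ) ≠ 0 := by
    obtain ⟨x, _⟩ := S.rel_nonempty 0
    have : Nonempty X := ⟨x⟩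
    exact_mod_cast Fintype.card_ne_zero
  have hmem := S.hadamard_mem_boseMesner (hE.mem i) (hE.mem j)
  rw [← hE.span_eq, Submodule.mem_span_range_iff_exists_fun] at hmem
  obtain ⟨g, hg⟩ := hmem
  have hk : ∀ k, krein E i j k = Fintype.card X * g k := by
    intro k
    rw [krein, ← hg, hE.sum_smul_mul g k, Matrix.trace_smul, smul_eq_mul]
    field_simp [hE.trace_ne_zero k]
  simp only [hk, mul_smul]
  rw [← Finset.smul_sum, smul_smul, inv_mul_cancel₀ hX, one_smul, hg]

end AssocScheme

namespace AssocScheme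

/-! ### Entries and traces in the Bose–Mesner algebra -/

section Matrices

variable {X : Type*} [Fintype X] {d : ℕ}

/-! Read `M = |X| E₁` as the Gram matrix of vectors indexed by `X`. `Q`-antipodality makes every
class (fibre) of `R₀ ∪ R₂` a regular simplex, and the vectors of one fibre already form a tight
frame of the whole space (`IsQPolynomial.exists_isLinkedSimplices`). Everything then turns on the
third moment `T(x,y,z) = ∑ w, M x w * M y w * M z w`. It satisfies `T(x,x,z) = γ * M x z` for a
constant `γ`, and `a₁* = 0` exactly when `γ = 0`, since `a₁*` is a nonzero multiple of `∑ x,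
T(x,x,x)`.

If `γ = 0`, the tight frame identity reduces `∑ T²` to terms `T(x,w,w) = 0`, so `T` vanishes
(`thirdMoment_eq_zero`). Functions of the relation are spanned by `1`, the indicator of `R₀`, the
fibre indicator and `θ`, the entry of `M`; all triple sums of these other than `T` are determined by
the relations in any case, so the scheme is triply regular (`dependsOnRel_of_theta`).

Conversely, triple regularity makes `T` a function of the relations. This determines `(v - 2)
T(x,y,·)` for distinct `x`, `y` in one fibre, and one more sum over that fibre yields `γ = 0`
(`momentRatio_eq_zero`). -/

theorem exists_eq_of_mem_boseMesner (S : AssocScheme X d) {A : Matrix X X ℝ}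
    (hA : A ∈ S.boseMesner) : ∃ f : Fin (d + 1) → ℝ, ∀ x y, A x y = f (S.rel x y) := by
  unfold boseMesner at hA
  rw [Submodule.mem_span_range_iff_exists_fun] at hA
  obtain ⟨g, rfl⟩ := hA
  refine ⟨g, fun x y => ?_⟩
  simp [Matrix.sum_apply, adj]

theorem symm_of_mem_boseMesner (S : AssocScheme X d) {A : Matrix X X ℝ}
    (hA : A ∈ S.boseMesner) (x y : X) : A x y = A y x := by
  obtain ⟨f, hf⟩ := S.exists_eq_of_mem_boseMesner hA
  rw [hf, hf, S.rel_symm]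

theorem trace_hadamard_mul_of_mem (S : AssocScheme X d) {A B C : Matrix X X ℝ}
    (hC : C ∈ S.boseMesner) :
    ((A ⊙ B) * C).trace = ∑ x, ∑ y, A x y * B x y * C x y := by
  simp only [Matrix.trace, Matrix.diag, Matrix.mul_apply, Matrix.hadamard_apply]
  exact Finset.sum_congr rfl fun x _ => Finset.sum_congr rfl fun y _ => by
    rw [S.symm_of_mem_boseMesner hC y x]

theorem trace_mul_of_mem (S : AssocScheme X d) (A : Matrix X X ℝ) {B : Matrix X X ℝ}
    (hB : B ∈ S.boseMesner) : (A * B).trace = ∑ x, ∑ y, A x y * B x y := by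
  simp only [Matrix.trace, Matrix.diag, Matrix.mul_apply]
  exact Finset.sum_congr rfl fun x _ => Finset.sum_congr rfl fun y _ => by
    rw [S.symm_of_mem_boseMesner hB y x]

theorem card_ne_zero (S : AssocScheme X d) : (Fintype.card X : ℝ) ≠ 0 := by
  obtain ⟨x, _⟩ := S.rel_nonempty 0
  have : Nonempty X := ⟨x⟩
  exact_mod_cast Fintype.card_ne_zero

end Matrices

/-! ### Krein numbers forced by the two polynomial and antipodal conditions -/

section Krein

variable {X : Type*} [Fintype X] [DecidableEq X] {S : AssocScheme X 3}
  {E : Fin 4 → Matrix X X ℝ}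

theorem IsPrimitiveIdempotents.zero_apply {d : ℕ} {S : AssocScheme X d}
    {E : Fin (d + 1) → Matrix X X ℝ} (hE : S.IsPrimitiveIdempotents E) (x y : X) :
    E 0 x y = (Fintype.card X : ℝ)⁻¹ := by
  rw [hE.zero_eq]; simp

theorem IsPrimitiveIdempotents.sum_mul_ne {d : ℕ} {S : AssocScheme X d}
    {E : Fin (d + 1) → Matrix X X ℝ} (hE : S.IsPrimitiveIdempotents E)
    {i j : Fin (d + 1)} (hij : i ≠ j) : ∑ x, ∑ y, E i x y * E j x y = 0 := by
  rw [← S.trace_mul_of_mem _ (hE.mem j), hE.mul_ne i j hij, Matrix.trace_zero]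

theorem IsPrimitiveIdempotents.sum_mul_self {d : ℕ} {S : AssocScheme X d}
    {E : Fin (d + 1) → Matrix X X ℝ} (hE : S.IsPrimitiveIdempotents E)
    (i : Fin (d + 1)) : ∑ x, ∑ y, E i x y * E i x y = (E i).trace := by
  rw [← S.trace_mul_of_mem _ (hE.mem i), hE.mul_self]

theorem IsPrimitiveIdempotents.trace_zero_eq_one {d : ℕ} {S : AssocScheme X d}
    {E : Fin (d + 1) → Matrix X X ℝ} (hE : S.IsPrimitiveIdempotents E) : (E 0).trace = 1 := by
  simp [Matrix.trace, hE.zero_apply, S.card_ne_zero]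

theorem IsPrimitiveIdempotents.krein_eq {d : ℕ} {S : AssocScheme X d}
    {E : Fin (d + 1) → Matrix X X ℝ} (hE : S.IsPrimitiveIdempotents E) (i j k : Fin (d + 1)) :
    krein E i j k =
      Fintype.card X * (∑ x, ∑ y, E i x y * E j x y * E k x y) / (E k).trace := by
  rw [krein, S.trace_hadamard_mul_of_mem (hE.mem k)]

theorem exists_sq_eq_of_degree {p q r : Polynomial ℝ} (hp : p.degree = 0) (hq : q.degree = 1)
    (hr : r.degree = 2) :
    ∃ a b c : ℝ, ∀ t : ℝ, t ^ 2 = a * p.eval t + b * q.eval t + c * r.eval t := by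
  have hp0 := Polynomial.eq_C_of_degree_eq_zero hp
  have hq0 := Polynomial.eq_X_add_C_of_degree_eq_one hq
  have hr0 := Polynomial.eq_quadratic_of_degree_le_two hr.le
  have h1 : p.coeff 0 ≠ 0 := by
    intro h; rw [h, Polynomial.C_0] at hp0; simp [hp0] at hp
  have h2 : q.leadingCoeff ≠ 0 := by
    intro h; rw [Polynomial.leadingCoeff_eq_zero] at h; simp [h] at hq
  have h3 : r.coeff 2 ≠ 0 := Polynomial.coeff_ne_zero_of_eq_degree hr
  refine ⟨(-(r.coeff 0) + r.coeff 1 * q.coeff 0 / q.leadingCoeff) / (r.coeff 2 * p.coeff 0),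
    -(r.coeff 1) / (r.coeff 2 * q.leadingCoeff), 1 / r.coeff 2, fun t => ?_⟩
  have ep : p.eval t = p.coeff 0 := by rw [hp0]; simp
  have eq : q.eval t = q.leadingCoeff * t + q.coeff 0 := by
    conv_lhs => rw [hq0]
    simp
  have er : r.eval t = r.coeff 2 * t ^ 2 + r.coeff 1 * t + r.coeff 0 := by
    conv_lhs => rw [hr0]
    simp
  rw [ep, eq, er]
  field_simp
  ring

/-- The entrywise square of `E 1` is quadratic in `E 1`, hence a combination of `E 0`, `E 1`, `E 2`,
all orthogonal to `E 3`. -/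
theorem IsQPolynomial.sum_one_one_three (hQ : S.IsQPolynomial E) :
    ∑ x, ∑ y, E 1 x y * E 1 x y * E 3 x y = 0 := by
  obtain ⟨hE, hpoly⟩ := hQ
  obtain ⟨p, hp0, hp⟩ := hpoly 0
  obtain ⟨q, hq0, hq⟩ := hpoly 1
  obtain ⟨r, hr0, hr⟩ := hpoly 2
  obtain ⟨a, b, c, h⟩ := exists_sq_eq_of_degree (by simpa using hp0) (by simpa using hq0)
    (by simpa using hr0)
  have hX := S.card_ne_zero
  have key : ∀ x y, E 1 x y * E 1 x y * E 3 x y = (Fintype.card X : ℝ)⁻¹ *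
      (a * (E 0 x y * E 3 x y) + b * (E 1 x y * E 3 x y) + c * (E 2 x y * E 3 x y)) := by
    intro x y
    have := h (Fintype.card X * E 1 x y)
    rw [← hp, ← hq, ← hr] at this
    have hsq : Fintype.card X * (E 1 x y * E 1 x y) =
        a * E 0 x y + b * E 1 x y + c * E 2 x y := by
      apply mul_left_cancel₀ hX
      linear_combination this
    rw [eq_inv_mul_iff_mul_eq₀ hX]
    linear_combination E 3 x y * hsq
  simp only [key, ← Finset.mul_sum, Finset.sum_add_distrib,
    hE.sum_mul_ne (i := 0) (j := 3) (by decide),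
    hE.sum_mul_ne (i := 1) (j := 3) (by decide), hE.sum_mul_ne (i := 2) (j := 3) (by decide)]
  simp

theorem IsQPolynomial.krein_one_three_zero (hQ : S.IsQPolynomial E) : krein E 1 3 0 = 0 := by
  have hE := hQ.1
  rw [hE.krein_eq]
  simp [hE.zero_apply, ← Finset.sum_mul, hE.sum_mul_ne (i := 1) (j := 3) (by decide)]

theorem IsQPolynomial.krein_one_three_one (hQ : S.IsQPolynomial E) : krein E 1 3 1 = 0 := by
  have hE := hQ.1
  rw [hE.krein_eq]
  simp [mul_right_comm _ (E 3 _ _), hQ.sum_one_one_three]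

theorem IsPrimitiveIdempotents.diag_eq {d : ℕ} {S : AssocScheme X d}
    {E : Fin (d + 1) → Matrix X X ℝ} (hE : S.IsPrimitiveIdempotents E) (i : Fin (d + 1))
    (x : X) : Fintype.card X * E i x x = (E i).trace := by
  obtain ⟨f, hf⟩ := S.exists_eq_of_mem_boseMesner (hE.mem i)
  have h : ∀ x, E i x x = f 0 := fun x => by rw [hf, (S.rel_eq_zero_iff x x).2 rfl]
  simp [Matrix.trace, h]

theorem IsQPolynomial.krein_one_three_two (hQ : S.IsQPolynomial E) (ha : IsQAntipodal E) :
    krein E 1 3 2 = 1 := by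
  have hE := hQ.1
  have h := ha 2 (by decide)
  have hb : bStar E 2 = krein E 1 3 2 := by simp [bStar]
  have hc : cStar E (Fin.rev (2 : Fin 4)) = krein E 1 0 1 := by
    have : Fin.rev (2 : Fin 4) = 1 := by decide
    rw [this]; simp [cStar]
  rw [← hb, h, hc, hE.krein_eq]
  simp only [hE.zero_apply, mul_right_comm _ (Fintype.card X : ℝ)⁻¹, ← Finset.sum_mul,
    hE.sum_mul_self]
  have := hE.trace_ne_zero 1
  have := S.card_ne_zero
  field_simp

theorem IsQPolynomial.krein_one_three_three (hQ : S.IsQPolynomial E) (ha : IsQAntipodal E) :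
    krein E 1 3 3 = 0 := by
  have hE := hQ.1
  have h := ha 0 (by decide)
  have hb : bStar E 0 = krein E 1 1 0 := by simp [bStar]
  have hc : cStar E (Fin.rev (0 : Fin 4)) = krein E 1 2 3 := by
    have : Fin.rev (0 : Fin 4) = 3 := by decide
    rw [this]; simp [cStar]
  rw [hb, hc, hE.krein_eq, hE.krein_eq, hE.trace_zero_eq_one] at h
  simp only [hE.zero_apply, ← Finset.sum_mul, hE.sum_mul_self] at h
  have hX := S.card_ne_zero
  have ht := hE.trace_ne_zero 3
  have hone : ∀ x y, E 3 x y = (1 : Matrix X X ℝ) x y - E 0 x y - E 1 x y - E 2 x y := by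
    intro x y
    rw [← hE.sum_eq_one, Fin.sum_univ_four]
    simp only [Matrix.add_apply]
    ring
  -- Replacing one `E 3` by `1 - E 0 - E 1 - E 2` gives `q₁₀³ + q₁₁³ + q₁₂³ + q₁₃³ = tr E₁`. The
  -- first two terms vanish, and `h` says `q₁₂³ = b₀* = tr E₁`.
  have key : ∀ x y, E 1 x y * E 3 x y * E 3 x y = E 1 x y * (1 : Matrix X X ℝ) x y * E 3 x y
      - (Fintype.card X : ℝ)⁻¹ * (E 1 x y * E 3 x y) - E 1 x y * E 1 x y * E 3 x y
      - E 1 x y * E 2 x y * E 3 x y := by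
    intro x y
    rw [← hE.zero_apply x y]
    linear_combination E 1 x y * E 3 x y * hone x y
  have hdiag : ∑ x, ∑ y, E 1 x y * (1 : Matrix X X ℝ) x y * E 3 x y =
      (E 1).trace * (E 3).trace / Fintype.card X := by
    simp only [Matrix.one_apply, mul_ite, mul_one, mul_zero, ite_mul, zero_mul,
      Finset.sum_ite_eq, Finset.mem_univ, if_true]
    have h1 : ∀ x, E 1 x x = (E 1).trace / Fintype.card X := fun x => by
      rw [← hE.diag_eq 1 x]; field_simp
    simp only [h1]
    rw [← Finset.mul_sum, mul_div_right_comm]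
    rfl
  rw [hE.krein_eq]
  simp only [key, Finset.sum_sub_distrib, ← Finset.mul_sum, hdiag,
    hE.sum_mul_ne (i := 1) (j := 3) (by decide), hQ.sum_one_one_three]
  field_simp at h ⊢
  linear_combination h

/-- Among the Krein numbers `q₁₃ᵏ` only `q₁₃² = 1` survives. This is the form in which
`Q`-antipodality of the dual array is used from here on. -/
theorem IsQPolynomial.hadamard_one_three (hQ : S.IsQPolynomial E) (ha : IsQAntipodal E)
    (x y : X) : Fintype.card X * (E 1 x y * E 3 x y) = E 2 x y := by
  have h := congrFun (congrFun (hQ.1.hadamard_eq_sum_krein 1 3) x) y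
  rw [Fin.sum_univ_four] at h
  simp only [hQ.krein_one_three_zero, hQ.krein_one_three_one, hQ.krein_one_three_two ha,
    hQ.krein_one_three_three ha, Matrix.hadamard_apply] at h
  rw [h]
  simp [S.card_ne_zero]

/-- Every `E k` is a polynomial in `E 1`, so two relations with the same entry of `E 1` could not be
separated by any matrix in the span of the `E k`, which contains the adjacency matrices. -/
theorem IsQPolynomial.exists_injective (hQ : S.IsQPolynomial E) :
    ∃ θ : Fin 4 → ℝ, Function.Injective θ ∧
      ∀ x y, Fintype.card X * E 1 x y = θ (S.rel x y) := by
  obtain ⟨f, hf⟩ := S.exists_eq_of_mem_boseMesner (hQ.1.mem 1)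
  refine ⟨fun i => Fintype.card X * f i, fun i j hij => ?_, fun x y => by rw [hf]⟩
  obtain ⟨x, y, hi⟩ := S.rel_nonempty i
  obtain ⟨x', y', hj⟩ := S.rel_nonempty j
  have hXne := S.card_ne_zero
  have hEq : ∀ k, E k x y = E k x' y' := by
    intro k
    obtain ⟨p, -, hp⟩ := hQ.2 k
    have h1 := hp x y
    have h2 := hp x' y'
    rw [hf, hi] at h1
    rw [hf, hj] at h2
    simp only at hij
    rw [hij, ← h2] at h1
    exact mul_left_cancel₀ hXne h1
  have hadj : S.adj i ∈ S.boseMesner := Submodule.subset_span ⟨i, rfl⟩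
  rw [← hQ.1.span_eq, Submodule.mem_span_range_iff_exists_fun] at hadj
  obtain ⟨g, hg⟩ := hadj
  have h : S.adj i x y = S.adj i x' y' := by
    rw [← hg]
    simp [Matrix.sum_apply, hEq]
  simp only [adj, Matrix.of_apply, hi, hj, if_true] at h
  by_contra hne
  rw [if_neg (Ne.symm hne)] at h
  exact one_ne_zero h

end Krein

end AssocScheme

namespace AssocScheme

/-! ### Fibres as regular simplices and tight frames -/

section Fibres

variable {X : Type*} [Fintype X]

/-- The indicator of the relation `R₀ ∪ R₂`. -/
def fibre (S : AssocScheme X 3) (x y : X) : ℝ :=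
  if S.rel x y = 0 ∨ S.rel x y = 2 then 1 else 0

/-- `M` is the Gram matrix of a family of vectors, with entries depending injectively on the
relation, in which every class of `R₀ ∪ R₂` is a regular simplex with `v` vertices spanning the
whole space; `n` is the number of all vectors. -/
structure IsLinkedSimplices (S : AssocScheme X 3) (M : X → X → ℝ) (θ : Fin 4 → ℝ) (v n : ℝ) :
    Prop where
  apply_eq : ∀ x y, M x y = θ (S.rel x y)
  injective : Function.Injective θ
  theta_zero : θ 0 = v - 1
  theta_two : θ 2 = -1
  equivalence : Equivalence fun x y => S.rel x y = 0 ∨ S.rel x y = 2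
  v_ne_zero : v ≠ 0
  v_ne_one : v ≠ 1
  sum_apply : ∀ x, ∑ w, M x w = 0
  sum_fibre : ∀ x, ∑ w, S.fibre x w = v
  sum_fibre_mul : ∀ x y, ∑ w, S.fibre x w * M y w = 0
  sum_mul : ∀ x y, ∑ w, M x w * M y w = n * M x y
  sum_fibre_mul_mul : ∀ u x y, ∑ w, S.fibre u w * (M x w * M y w) = v * M x y

theorem fibre_symm (S : AssocScheme X 3) (x y : X) : S.fibre x y = S.fibre y x := by
  simp [fibre, S.rel_symm x y]

theorem fibre_mul_fibre {S : AssocScheme X 3}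
    (he : Equivalence fun x y => S.rel x y = 0 ∨ S.rel x y = 2)
    (u x y : X) : S.fibre u x * S.fibre x y = S.fibre u x * S.fibre u y := by
  unfold fibre
  by_cases h : S.rel u x = 0 ∨ S.rel u x = 2
  · have h1 : (S.rel x y = 0 ∨ S.rel x y = 2) ↔ (S.rel u y = 0 ∨ S.rel u y = 2) :=
      ⟨fun h' => he.trans h h', fun h' => he.trans (he.symm h) h'⟩
    simp only [h1]
  · simp [h]

theorem fibre_self (S : AssocScheme X 3) (x : X) : S.fibre x x = 1 := by
  simp [fibre, (S.rel_eq_zero_iff x x).2 rfl]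

theorem sum_adj_eq_fibre (S : AssocScheme X 3) :
    ∑ i ∈ ({0, 2} : Finset (Fin 4)), S.adj i = Matrix.of S.fibre := by
  ext x y
  rw [Finset.sum_pair (by decide)]
  simp only [adj, fibre, Matrix.add_apply, Matrix.of_apply]
  by_cases h0 : S.rel x y = 0 <;> by_cases h2 : S.rel x y = 2 <;> simp_all

/-- The difference `P - Q` is a symmetric idempotent of trace zero. -/
theorem eq_of_isSymm_of_mul_eq_of_trace_eq {P Q : Matrix X X ℝ} (hP : Pᵀ = P) (hQ : Qᵀ = Q)
    (hPP : P * P = P) (hQQ : Q * Q = Q) (hPQ : P * Q = Q) (hQP : Q * P = Q)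
    (ht : P.trace = Q.trace) : P = Q := by
  rw [← sub_eq_zero, ← Matrix.trace_conjTranspose_mul_self_eq_zero_iff,
    Matrix.conjTranspose_eq_transpose_of_trivial, Matrix.transpose_sub, hP, hQ, sub_mul, mul_sub,
    mul_sub, hPP, hQQ, hPQ, hQP, sub_self, sub_zero, Matrix.trace_sub, ht, sub_self]

variable [DecidableEq X] {S : AssocScheme X 3} {E : Fin 4 → Matrix X X ℝ}

/-- Since `|X| E₁ ∘ (E₀ + E₃) = E₁ + E₂ = 1 - (E₀ + E₃)`, inner products within a fibre are `c - 1`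
on the diagonal and `-1` off it: a regular simplex. -/
theorem IsQPolynomial.fibre_mul_apply (hQ : S.IsQPolynomial E) (ha : IsQAntipodal E) {c : ℝ}
    (hc : Matrix.of S.fibre = c • (E 0 + E 3)) (x y : X) :
    S.fibre x y * (Fintype.card X * E 1 x y) = c * (1 : Matrix X X ℝ) x y - S.fibre x y := by
  have h : S.fibre x y = c * (E 0 x y + E 3 x y) := congrFun (congrFun hc x) y
  have h13 := hQ.hadamard_one_three ha x y
  have hone : (1 : Matrix X X ℝ) x y = E 0 x y + E 1 x y + E 2 x y + E 3 x y := by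
    rw [← hQ.1.sum_eq_one, Fin.sum_univ_four]
    simp only [Matrix.add_apply]
  have h0 : Fintype.card X * E 0 x y = 1 := by
    rw [hQ.1.zero_apply, mul_inv_cancel₀ S.card_ne_zero]
  rw [h, hone]
  linear_combination c * h13 + c * E 1 x y * h0

/-- The tight frame property of one fibre: up to scaling, `E₁ D E₁` is a symmetric idempotent below
`E₁` of the same trace, hence equal to `E₁`. -/
theorem IsQPolynomial.one_mul_diagonal_fibre_mul_one (hQ : S.IsQPolynomial E)
    (ha : IsQAntipodal E) {c : ℝ} (hc : Matrix.of S.fibre = c • (E 0 + E 3)) (hc0 : c ≠ 0)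
    (he : Equivalence fun x y => S.rel x y = 0 ∨ S.rel x y = 2)
    (hsum : ∀ x, ∑ w, S.fibre x w = c) (u : X) :
    (Fintype.card X : ℝ) • (E 1 * Matrix.diagonal (S.fibre u) * E 1) = c • E 1 := by
  have hE := hQ.1
  have hX := S.card_ne_zero
  set n : ℝ := (Fintype.card X : ℝ)
  set D := Matrix.diagonal (S.fibre u) with hD
  set P := E 1 with hPdef
  have hPt : Pᵀ = P := by
    ext x y; exact S.symm_of_mem_boseMesner (hE.mem 1) y x
  have hPP : P * P = P := hE.mul_self 1
  have hKP : Matrix.of S.fibre * P = 0 := by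
    rw [hc, smul_mul_assoc, add_mul, hE.mul_ne 0 1 (by decide), hE.mul_ne 3 1 (by decide)]
    simp
  -- The block of `P` on the fibre of `u` is known from the simplex structure; its all-ones part is
  -- killed by `P` because of `hKP`.
  have hDPD : D * P * D = n⁻¹ • (c • D - D * Matrix.of S.fibre) := by
    ext x y
    simp only [hD, Matrix.diagonal_mul, Matrix.mul_diagonal, Matrix.smul_apply, Matrix.sub_apply,
      Matrix.of_apply, smul_eq_mul]
    have h1 := hQ.fibre_mul_apply ha hc x y
    have h2 := fibre_mul_fibre he u x y
    rw [eq_inv_mul_iff_mul_eq₀ hX, Matrix.diagonal_apply]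
    rw [Matrix.one_apply] at h1
    split_ifs at h1 ⊢ with hxy <;>
    linear_combination S.fibre u x * h1 - n * P x y * h2
  have hQQ : P * D * P * (P * D * P) = (n⁻¹ * c) • (P * D * P) := by
    calc P * D * P * (P * D * P) = P * (D * (P * P) * D) * P := by noncomm_ring
      _ = (n⁻¹ * c) • (P * D * P) - n⁻¹ • (P * D * (Matrix.of S.fibre * P)) := by
        rw [hPP, hDPD]
        simp only [mul_smul_comm, smul_mul_assoc, mul_sub, sub_mul, smul_sub, smul_smul, mul_assoc]
      _ = _ := by rw [hKP]; simp
  have hdiag : ∀ x, n * P x x = c - 1 := by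
    intro x
    have h1 := hQ.fibre_mul_apply ha hc x x
    simpa [S.fibre_self] using h1
  have htr : (P * D * P).trace = n⁻¹ * c * P.trace := by
    rw [Matrix.trace_mul_comm, ← mul_assoc, hPP, ← hE.diag_eq 1 u]
    change ∑ x, (P * D) x x = n⁻¹ * c * (n * P u u)
    simp only [hD, Matrix.mul_diagonal]
    have : ∀ x, P x x * S.fibre u x = n⁻¹ * (c - 1) * S.fibre u x := by
      intro x; rw [← hdiag x]; field_simp
    simp only [this, ← Finset.mul_sum, hsum, hdiag]
    ring
  have hmain : P = (n * c⁻¹) • (P * D * P) := by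
    apply eq_of_isSymm_of_mul_eq_of_trace_eq hPt _ hPP
    · rw [smul_mul_smul_comm, hQQ, smul_smul]
      congr 1
      field_simp
    · rw [mul_smul_comm, ← mul_assoc, ← mul_assoc, hPP]
    · rw [smul_mul_assoc, mul_assoc, hPP]
    · rw [Matrix.trace_smul, htr, smul_eq_mul]
      field_simp
    · rw [Matrix.transpose_smul, Matrix.transpose_mul, Matrix.transpose_mul, hPt, hD,
        Matrix.diagonal_transpose, mul_assoc]
  conv_rhs => rw [hmain, smul_smul]
  congr 1
  field_simp

theorem IsQPolynomial.exists_isLinkedSimplices (hQ : S.IsQPolynomial E) (ha : IsQAntipodal E)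
    (hrel : S.IsQAntipodalRelation E {0, 2}) :
    ∃ θ v, S.IsLinkedSimplices (fun x y => Fintype.card X * E 1 x y) θ v (Fintype.card X) := by
  obtain ⟨θ, hθ, hM⟩ := hQ.exists_injective
  obtain ⟨he, c, hc⟩ := hrel
  rw [sum_adj_eq_fibre] at hc
  change Matrix.of S.fibre = c • (E 0 + E 3) at hc
  replace he : Equivalence fun x y => S.rel x y = 0 ∨ S.rel x y = 2 := by simpa using he
  have hE := hQ.1
  have hX := S.card_ne_zero
  obtain ⟨x₀, y₀, h2⟩ := S.rel_nonempty 2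
  have hxy : x₀ ≠ y₀ := fun h => by
    rw [(S.rel_eq_zero_iff _ _).2 h] at h2; exact absurd h2 (by decide)
  have hc0 : c ≠ 0 := by
    rintro rfl
    have := congrFun (congrFun hc x₀) x₀
    simp [S.fibre_self] at this
  have hsum : ∀ x, ∑ w, S.fibre x w = c := by
    intro x
    have h : Matrix.of S.fibre * E 0 = c • E 0 := by
      rw [hc, smul_mul_assoc, add_mul, hE.mul_self, hE.mul_ne 3 0 (by decide), add_zero]
    have := congrFun (congrFun h x) x
    simp only [Matrix.mul_apply, Matrix.of_apply, hE.zero_apply, ← Finset.sum_mul,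
      Matrix.smul_apply, smul_eq_mul] at this
    exact mul_right_cancel₀ (inv_ne_zero hX) this
  have hKP : Matrix.of S.fibre * E 1 = 0 := by
    rw [hc, smul_mul_assoc, add_mul, hE.mul_ne 0 1 (by decide), hE.mul_ne 3 1 (by decide)]
    simp
  have hs : ∀ x y, E 1 x y = E 1 y x := S.symm_of_mem_boseMesner (hE.mem 1)
  have h0 : θ 0 = c - 1 := by
    have h1 := hQ.fibre_mul_apply ha hc x₀ x₀
    rw [hM, (S.rel_eq_zero_iff _ _).2 rfl, S.fibre_self] at h1
    simpa using h1
  refine ⟨θ, c, hM, hθ, h0, ?_, he, hc0, ?_, ?_, hsum, ?_, ?_, ?_⟩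
  · have h1 := hQ.fibre_mul_apply ha hc x₀ y₀
    rw [hM, h2, Matrix.one_apply_ne hxy] at h1
    simpa [fibre, h2] using h1
  · intro h1
    apply hE.trace_ne_zero 1
    rw [← hE.diag_eq 1 x₀, hM, (S.rel_eq_zero_iff _ _).2 rfl, h0, h1, sub_self]
  · intro x
    have h := congrFun (congrFun (hE.mul_ne 1 0 (by decide)) x) x
    simp only [Matrix.mul_apply, hE.zero_apply, ← Finset.sum_mul, Matrix.zero_apply] at h
    rw [← Finset.mul_sum, (mul_eq_zero.1 h).resolve_right (inv_ne_zero hX), mul_zero]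
  · intro x y
    have h := congrFun (congrFun hKP x) y
    simp only [Matrix.mul_apply, Matrix.of_apply, Matrix.zero_apply] at h
    simp only [hs y, mul_left_comm (S.fibre x _), ← Finset.mul_sum, h, mul_zero]
  · intro x y
    have h := congrFun (congrFun (hE.mul_self 1) x) y
    rw [Matrix.mul_apply] at h
    rw [← h, Finset.mul_sum, Finset.mul_sum]
    exact Finset.sum_congr rfl fun w _ => by rw [hs y w]; ring
  · intro u x y
    have h := congrFun (congrFun (hQ.one_mul_diagonal_fibre_mul_one ha hc hc0 he hsum u) x) y
    simp only [Matrix.smul_apply, Matrix.mul_apply (N := E 1), Matrix.mul_diagonal,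
      smul_eq_mul] at h
    rw [mul_left_comm, ← h, Finset.mul_sum, Finset.mul_sum]
    exact Finset.sum_congr rfl fun w _ => by rw [hs y w]; ring

end Fibres

end AssocScheme

namespace AssocScheme

/-! ### Third moments of linked simplices -/

section TripleSums

variable {X : Type*} [Fintype X] {S : AssocScheme X 3} {M : X → X → ℝ} {θ : Fin 4 → ℝ} {v n : ℝ}

/-- The third moment `∑ w, ⟨x, w⟩ ⟨y, w⟩ ⟨z, w⟩` of a family of vectors with Gram matrix `M`. -/
def thirdMoment (M : X → X → ℝ) (x y z : X) : ℝ := ∑ w, M x w * M y w * M z w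

theorem thirdMoment_swap_left (M : X → X → ℝ) (x y z : X) :
    thirdMoment M x y z = thirdMoment M y x z :=
  Finset.sum_congr rfl fun w _ => by ring

theorem thirdMoment_swap_right (M : X → X → ℝ) (x y z : X) :
    thirdMoment M x y z = thirdMoment M x z y :=
  Finset.sum_congr rfl fun w _ => by ring

/-- The number `γ` with `thirdMoment M x x z = γ * M x z`. -/
def momentRatio (θ : Fin 4 → ℝ) (v n : ℝ) : ℝ := (v - 2) * v + (θ 1 + θ 3) * (n - v)

namespace IsLinkedSimplices

theorem symm (h : S.IsLinkedSimplices M θ v n) (x y : X) : M x y = M y x := by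
  rw [h.apply_eq, h.apply_eq, S.rel_symm]

theorem diag (h : S.IsLinkedSimplices M θ v n) (x : X) : M x x = v - 1 := by
  rw [h.apply_eq, (S.rel_eq_zero_iff x x).2 rfl, h.theta_zero]

/-- Inside a fibre `M` takes only the values `v - 1` and `-1`, outside only `θ 1` and `θ 3`; each
pair consists of the roots of a quadratic, so squares become linear. -/
theorem sq_eq (h : S.IsLinkedSimplices M θ v n)
    (x w : X) : M x w * M x w =
    S.fibre x w * ((v - 2) * M x w + (v - 1)) +
    (1 - S.fibre x w) * ((θ 1 + θ 3) * M x w - θ 1 * θ 3) := by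
  rw [h.apply_eq, fibre]
  have h0 := h.theta_zero
  have h2 := h.theta_two
  generalize S.rel x w = r
  fin_cases r <;> simp [h0, h2] <;> ring

theorem thirdMoment_self_left (h : S.IsLinkedSimplices M θ v n) (x z : X) :
    thirdMoment M x x z = momentRatio θ v n * M x z := by
  have key : ∀ w, M x w * M x w * M z w =
      (v - 2 - θ 1 - θ 3) * (S.fibre x w * (M x w * M z w)) +
      (v - 1 + θ 1 * θ 3) * (S.fibre x w * M z w) + (θ 1 + θ 3) * (M x w * M z w) -
      θ 1 * θ 3 * M z w := fun w => by rw [h.sq_eq]; ring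
  simp only [thirdMoment, key, Finset.sum_add_distrib, Finset.sum_sub_distrib, ← Finset.mul_sum,
    h.sum_fibre_mul_mul, h.sum_fibre_mul, h.sum_mul, h.sum_apply, momentRatio]
  ring

theorem sum_fibre_mul_thirdMoment (h : S.IsLinkedSimplices M θ v n) (u x y : X) :
    ∑ z, S.fibre u z * thirdMoment M x y z = 0 := by
  simp only [thirdMoment, Finset.mul_sum]
  rw [Finset.sum_comm]
  refine Finset.sum_eq_zero fun w _ => ?_
  have : ∀ z, S.fibre u z * (M x w * M y w * M z w) = M x w * M y w * (S.fibre u z * M w z) :=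
    fun z => by rw [h.symm w z]; ring
  simp only [this, ← Finset.mul_sum, h.sum_fibre_mul, mul_zero]

/-- The moment is linear in its third vector, so the frame identity of a single fibre reproduces it
at any point `a`. -/
theorem sum_fibre_mul_mul_thirdMoment (h : S.IsLinkedSimplices M θ v n) (u a x y : X) :
    ∑ z, S.fibre u z * (M a z * thirdMoment M x y z) = v * thirdMoment M x y a := by
  simp only [thirdMoment, Finset.mul_sum]
  rw [Finset.sum_comm]
  refine Finset.sum_congr rfl fun w _ => ?_
  have : ∀ z, S.fibre u z * (M a z * (M x w * M y w * M z w)) =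
      M x w * M y w * (S.fibre u z * (M a z * M w z)) :=
    fun z => by rw [h.symm w z]; ring
  simp only [this, ← Finset.mul_sum, h.sum_fibre_mul_mul]
  ring

theorem sum_mul_thirdMoment (h : S.IsLinkedSimplices M θ v n) (a x y : X) :
    ∑ z, M a z * thirdMoment M x y z = n * thirdMoment M x y a := by
  simp only [thirdMoment, Finset.mul_sum]
  rw [Finset.sum_comm]
  refine Finset.sum_congr rfl fun w _ => ?_
  have : ∀ z, M a z * (M x w * M y w * M z w) = M x w * M y w * (M a z * M w z) :=
    fun z => by rw [h.symm w z]; ring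
  simp only [this, ← Finset.mul_sum, h.sum_mul]
  ring

theorem thirdMoment_eq_zero (h : S.IsLinkedSimplices M θ v n)
    (hγ : momentRatio θ v n = 0) (x y z : X) :
    thirdMoment M x y z = 0 := by
  have hxx : ∀ x z, thirdMoment M x x z = 0 := fun x z => by
    rw [h.thirdMoment_self_left, hγ, zero_mul]
  -- Expand one factor over `w`. The frame identity, applied to the sum over `z` and then to the sum
  -- over `y`, moves `w` into both slots and leaves multiples of `T(x,w,w)`, which is zero.
  have hs : ∑ x, ∑ y, ∑ z, thirdMoment M x y z ^ 2 = 0 := by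
    calc ∑ x, ∑ y, ∑ z, thirdMoment M x y z ^ 2
        = ∑ x, ∑ y, ∑ z, ∑ w, M x w * M y w * (M w z * thirdMoment M x y z) := by
          refine Finset.sum_congr rfl fun x _ => Finset.sum_congr rfl fun y _ =>
            Finset.sum_congr rfl fun z _ => ?_
          rw [sq]
          nth_rewrite 1 [thirdMoment]
          rw [Finset.sum_mul]
          exact Finset.sum_congr rfl fun w _ => by rw [h.symm w z]; ring
      _ = ∑ x, ∑ y, ∑ w, M x w * (n * (M w y * thirdMoment M x w y)) := by
          refine Finset.sum_congr rfl fun x _ => Finset.sum_congr rfl fun y _ => ?_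
          rw [Finset.sum_comm]
          refine Finset.sum_congr rfl fun w _ => ?_
          rw [← Finset.mul_sum, h.sum_mul_thirdMoment, h.symm w y,
            thirdMoment_swap_right M x w y]
          ring
      _ = 0 := by
          refine Finset.sum_eq_zero fun x _ => ?_
          rw [Finset.sum_comm]
          refine Finset.sum_eq_zero fun w _ => ?_
          rw [← Finset.mul_sum, ← Finset.mul_sum, h.sum_mul_thirdMoment,
            thirdMoment_swap_left, thirdMoment_swap_right, hxx]
          simp
  have h1 := (Finset.sum_eq_zero_iff_of_nonneg (fun x _ => by positivity)).1
    hs x (Finset.mem_univ x)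
  have h2 := (Finset.sum_eq_zero_iff_of_nonneg (fun x _ => by positivity)).1
    h1 y (Finset.mem_univ y)
  have h3 := (Finset.sum_eq_zero_iff_of_nonneg (fun x _ => by positivity)).1
    h2 z (Finset.mem_univ z)
  exact pow_eq_zero_iff (two_ne_zero) |>.1 h3

theorem sum_thirdMoment_diag_eq_zero_iff (h : S.IsLinkedSimplices M θ v n) [Nonempty X] :
    ∑ x, thirdMoment M x x x = 0 ↔ momentRatio θ v n = 0 := by
  have hv : v - 1 ≠ 0 := sub_ne_zero.2 h.v_ne_one
  simp [h.thirdMoment_self_left, h.diag, hv]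

end IsLinkedSimplices

/-! ### Dependence on relations forces the moment ratio to vanish -/

/-- A function of three points that depends only on the relations between them. -/
def DependsOnRel (S : AssocScheme X 3) (G : X → X → X → ℝ) : Prop :=
  ∃ g : Fin 4 → Fin 4 → Fin 4 → ℝ, ∀ x y z, G x y z = g (S.rel x y) (S.rel y z) (S.rel z x)

namespace IsLinkedSimplices

theorem thirdMoment_of_fibre (h : S.IsLinkedSimplices M θ v n) [DecidableEq X]
    (hT : S.DependsOnRel (thirdMoment M)) {x y z : X}
    (hxy : S.rel x y = 2) (hz : S.rel x z = 0 ∨ S.rel x z = 2) :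
    (v - 2) * thirdMoment M x y z = -momentRatio θ v n * (M z x + M z y) := by
  obtain ⟨g, hg⟩ := hT
  set γ := momentRatio θ v n
  have hMxy : M x y = -1 := by rw [h.apply_eq, hxy, h.theta_two]
  have hne : x ≠ y := fun e => by
    rw [(S.rel_eq_zero_iff _ _).2 e] at hxy; exact absurd hxy (by decide)
  have hTx : thirdMoment M x y x = -γ := by
    rw [thirdMoment_swap_right, h.thirdMoment_self_left, hMxy]; ring
  have hTy : thirdMoment M x y y = -γ := by
    rw [thirdMoment_swap_left, thirdMoment_swap_right, h.thirdMoment_self_left, h.symm, hMxy]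
    ring
  have hcls : ∀ w, (S.rel x w = 0 ∨ S.rel x w = 2) → w ≠ x → w ≠ y →
      S.rel y w = 2 ∧ S.rel w x = 2 := by
    intro w hw hwx hwy
    refine ⟨(h.equivalence.trans (h.equivalence.symm (Or.inr hxy)) hw).resolve_left fun e => ?_,
      (h.equivalence.symm hw).resolve_left fun e => ?_⟩
    · exact hwy ((S.rel_eq_zero_iff _ _).1 e).symm
    · exact hwx ((S.rel_eq_zero_iff _ _).1 e)
  by_cases hzx : z = x
  · subst hzx
    rw [hTx, h.diag, hMxy]; ring
  by_cases hzy : z = y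
  · subst hzy
    rw [hTy, h.diag, h.symm, hMxy]; ring
  -- On the fibre the moment is `-γ` at `x` and `y` and one unknown constant `g 2 2 2` elsewhere.
  -- Its sum over the fibre is zero, whence `(v - 2) * g 2 2 2 = 2 * γ`.
  have key : ∀ w, S.fibre x w * thirdMoment M x y w = S.fibre x w * g 2 2 2 +
      ((if w = x then -γ - g 2 2 2 else 0) + (if w = y then -γ - g 2 2 2 else 0)) := by
    intro w
    by_cases hwx : w = x
    · subst hwx
      rw [hTx, S.fibre_self, if_pos rfl, if_neg hne]; ring
    by_cases hwy : w = y
    · subst hwy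
      rw [hTy, if_pos rfl, if_neg hwx]
      simp [fibre, hxy]
    by_cases hw : S.rel x w = 0 ∨ S.rel x w = 2
    · rw [hg, hxy, (hcls w hw hwx hwy).1, (hcls w hw hwx hwy).2, if_neg hwx, if_neg hwy]
      ring
    · simp [fibre, hw, hwx, hwy]
  have hs := h.sum_fibre_mul_thirdMoment x x y
  simp only [key, Finset.sum_add_distrib, ← Finset.sum_mul, h.sum_fibre, Finset.sum_ite_eq',
    Finset.mem_univ, if_true] at hs
  obtain ⟨h1, h2⟩ := hcls z hz hzx hzy
  rw [hg, hxy, h1, h2, h.apply_eq z x, h.apply_eq z y, h2, S.rel_symm z y, h1, h.theta_two]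
  linear_combination hs

/-- Both sides are linear in the vector of `a`, and the fibre of `x`, where the identity is already
known, is a tight frame. -/
theorem thirdMoment_eq_of_rel_eq_two (h : S.IsLinkedSimplices M θ v n) [DecidableEq X]
    (hT : S.DependsOnRel (thirdMoment M))
    {x y : X} (hxy : S.rel x y = 2) (a : X) :
    (v - 2) * thirdMoment M x y a = -momentRatio θ v n * (M a x + M a y) := by
  have key : ∀ z, (v - 2) * (S.fibre x z * (M a z * thirdMoment M x y z)) =
      -momentRatio θ v n * (S.fibre x z * (M a z * M x z) + S.fibre x z * (M a z * M y z)) := by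
    intro z
    by_cases hz : S.rel x z = 0 ∨ S.rel x z = 2
    · have := h.thirdMoment_of_fibre hT hxy hz
      rw [h.symm x z, h.symm y z]
      linear_combination S.fibre x z * M a z * this
    · simp [fibre, hz]
  have hs := Finset.sum_congr rfl fun z (_ : z ∈ Finset.univ) => key z
  simp only [← Finset.mul_sum, Finset.sum_add_distrib, h.sum_fibre_mul_mul_thirdMoment,
    h.sum_fibre_mul_mul] at hs
  apply mul_left_cancel₀ h.v_ne_zero
  linear_combination hs

theorem momentRatio_eq_zero (h : S.IsLinkedSimplices M θ v n) [DecidableEq X]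
    (hT : S.DependsOnRel (thirdMoment M)) :
    momentRatio θ v n = 0 := by
  obtain ⟨x, a, hxa⟩ := S.rel_nonempty 1
  set γ := momentRatio θ v n with hγ
  -- The formula for related pairs fails at `y = x`; the last term is the correction there. Summed
  -- over `y`, this says that `γ * v` times the quadratic with roots `θ 0`, `θ 2` vanishes at `θ 1`.
  have key : ∀ y, (v - 2) * (S.fibre x y * (M a y * thirdMoment M x a y)) =
      -γ * (M a x * (S.fibre x y * M a y) + S.fibre x y * (M a y * M a y)) +
      (if y = x then γ * v * M a x ^ 2 else 0) := by
    intro y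
    by_cases hyx : y = x
    · subst hyx
      rw [thirdMoment_swap_right, h.thirdMoment_self_left, S.fibre_self, if_pos rfl, h.symm y a]
      ring
    by_cases hy : S.rel x y = 0 ∨ S.rel x y = 2
    · have hy2 : S.rel x y = 2 :=
        hy.resolve_left fun e => hyx ((S.rel_eq_zero_iff _ _).1 e).symm
      have := h.thirdMoment_eq_of_rel_eq_two hT hy2 a
      rw [if_neg hyx, thirdMoment_swap_right]
      linear_combination S.fibre x y * M a y * this
    · simp [fibre, hy, hyx]
  have hs := Finset.sum_congr rfl fun z (_ : z ∈ Finset.univ) => key z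
  simp only [← Finset.mul_sum, Finset.sum_add_distrib, h.sum_fibre_mul_mul_thirdMoment,
    h.sum_fibre_mul_mul, h.sum_fibre_mul, Finset.sum_ite_eq', Finset.mem_univ, if_true,
    h.diag] at hs
  rw [thirdMoment_swap_left, thirdMoment_swap_right, h.thirdMoment_self_left, h.apply_eq,
    S.rel_symm, hxa] at hs
  have hprod : γ * (v * ((θ 1 - θ 0) * (θ 1 - θ 2))) = 0 := by
    rw [h.theta_zero, h.theta_two]
    linear_combination -hs
  refine (mul_eq_zero.1 hprod).resolve_right (mul_ne_zero h.v_ne_zero (mul_ne_zero ?_ ?_)) <;>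
  exact sub_ne_zero.2 fun e => absurd (h.injective e) (by decide)

end IsLinkedSimplices

end TripleSums

end AssocScheme

namespace AssocScheme

/-! ### Triple regularity through triple sums -/

section TripleRegularity

variable {X : Type*} [Fintype X] {S : AssocScheme X 3}

/-- The sum over all points `w` of products of functions of the relations of `x`, `y`, `z`
to `w`. -/
def tripleSum (S : AssocScheme X 3) (f g h : Fin 4 → ℝ) (x y z : X) : ℝ :=
  ∑ w, f (S.rel x w) * g (S.rel y w) * h (S.rel z w)

theorem DependsOnRel.swap_left {f g h : Fin 4 → ℝ} (H : S.DependsOnRel (S.tripleSum f g h)) :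
    S.DependsOnRel (S.tripleSum g f h) := by
  obtain ⟨φ, hφ⟩ := H
  refine ⟨fun i j k => φ i k j, fun x y z => ?_⟩
  beta_reduce
  rw [S.rel_symm x y, S.rel_symm z x, S.rel_symm y z, ← hφ]
  exact Finset.sum_congr rfl fun w _ => by ring

theorem DependsOnRel.swap_right {f g h : Fin 4 → ℝ} (H : S.DependsOnRel (S.tripleSum f g h)) :
    S.DependsOnRel (S.tripleSum f h g) := by
  obtain ⟨φ, hφ⟩ := H
  refine ⟨fun i j k => φ k j i, fun x y z => ?_⟩
  beta_reduce
  rw [S.rel_symm x y, S.rel_symm z x, S.rel_symm y z, ← hφ]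
  exact Finset.sum_congr rfl fun w _ => by ring

theorem DependsOnRel.add_left {f f' g h : Fin 4 → ℝ} (H : S.DependsOnRel (S.tripleSum f g h))
    (H' : S.DependsOnRel (S.tripleSum f' g h)) : S.DependsOnRel (S.tripleSum (f + f') g h) := by
  obtain ⟨φ, hφ⟩ := H
  obtain ⟨ψ, hψ⟩ := H'
  refine ⟨fun i j k => φ i j k + ψ i j k, fun x y z => ?_⟩
  simp only [← hφ, ← hψ, tripleSum, Pi.add_apply, add_mul, Finset.sum_add_distrib]

theorem DependsOnRel.smul_left {f g h : Fin 4 → ℝ} (c : ℝ)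
    (H : S.DependsOnRel (S.tripleSum f g h)) : S.DependsOnRel (S.tripleSum (c • f) g h) := by
  obtain ⟨φ, hφ⟩ := H
  refine ⟨fun i j k => c * φ i j k, fun x y z => ?_⟩
  simp only [← hφ, tripleSum, Pi.smul_apply, smul_eq_mul, Finset.mul_sum, mul_assoc]

theorem exists_sum_mul_eq (S : AssocScheme X 3) (f g : Fin 4 → ℝ) :
    ∃ φ : Fin 4 → ℝ, ∀ x y, ∑ w, f (S.rel x w) * g (S.rel y w) = φ (S.rel x y) := by
  choose p hp using S.exists_intersection_number
  refine ⟨fun k => ∑ i, ∑ j, f i * g j * p i j k, fun x y => ?_⟩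
  have : ∀ w, f (S.rel x w) * g (S.rel y w) =
      ∑ i, ∑ j, f i * g j * if S.rel x w = i ∧ S.rel w y = j then 1 else 0 := by
    intro w
    rw [S.rel_symm y w, Finset.sum_eq_single (S.rel x w), Finset.sum_eq_single (S.rel w y)]
    · simp
    · intro j _ hj; simp [hj.symm]
    · simp
    · intro i _ hi; simp [hi.symm]
    · simp
  simp only [this]
  rw [Finset.sum_comm]
  refine Finset.sum_congr rfl fun i _ => ?_
  rw [Finset.sum_comm]
  refine Finset.sum_congr rfl fun j _ => ?_
  rw [← Finset.mul_sum, Finset.sum_boole, hp i j _ x y rfl]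

theorem dependsOnRel_one (S : AssocScheme X 3) (g h : Fin 4 → ℝ) :
    S.DependsOnRel (S.tripleSum 1 g h) := by
  obtain ⟨φ, hφ⟩ := S.exists_sum_mul_eq g h
  refine ⟨fun _ j _ => φ j, fun x y z => ?_⟩
  simp [tripleSum, hφ]

theorem dependsOnRel_single_zero (S : AssocScheme X 3) (g h : Fin 4 → ℝ) :
    S.DependsOnRel (S.tripleSum (Pi.single 0 1) g h) := by
  refine ⟨fun i _ k => g i * h k, fun x y z => ?_⟩
  rw [tripleSum, Finset.sum_eq_single x]
  · simp [(S.rel_eq_zero_iff x x).2 rfl, S.rel_symm y x]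
  · intro w _ hw
    have : S.rel x w ≠ 0 := fun e => hw ((S.rel_eq_zero_iff _ _).1 e).symm
    simp [this]
  · simp

/-- The indicator of `{0, 2}`, so that `fibreFun (S.rel x y) = S.fibre x y`. -/
def fibreFun (i : Fin 4) : ℝ := if i = 0 ∨ i = 2 then 1 else 0

/-- The four functions form a basis: `1` and `θ` separate `1` from `3`, `fibreFun` then adjusts the
value at `2`, and the indicator of `0` the value at `0`. -/
theorem relFun_induction {θ : Fin 4 → ℝ} (hθ : θ 1 ≠ θ 3) {p : (Fin 4 → ℝ) → Prop}
    (hadd : ∀ f g, p f → p g → p (f + g)) (hsmul : ∀ (c : ℝ) f, p f → p (c • f))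
    (one : p 1) (single : p (Pi.single 0 1)) (theta : p θ) (fib : p fibreFun)
    (f : Fin 4 → ℝ) : p f := by
  have hne : θ 1 - θ 3 ≠ 0 := sub_ne_zero.2 hθ
  set b := (f 1 - f 3) / (θ 1 - θ 3) with hb
  have hb' : b * (θ 1 - θ 3) = f 1 - f 3 := div_mul_cancel₀ _ hne
  have : f = (f 1 - b * θ 1) • (1 : Fin 4 → ℝ) + b • θ +
      (f 2 - (f 1 - b * θ 1) - b * θ 2) • fibreFun +
      (f 0 - f 2 - b * (θ 0 - θ 2)) • Pi.single 0 1 := by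
    ext i
    fin_cases i <;> simp [fibreFun] <;> linarith
  rw [this]
  exact hadd _ _ (hadd _ _ (hadd _ _ (hsmul _ _ one) (hsmul _ _ theta)) (hsmul _ _ fib))
    (hsmul _ _ single)

theorem IsTriplyRegular.dependsOnRel (hS : S.IsTriplyRegular) (f g h : Fin 4 → ℝ) :
    S.DependsOnRel (S.tripleSum f g h) := by
  choose p hp using hS
  refine ⟨fun i j k => ∑ l, ∑ m, ∑ r, f l * g m * h r * p i j k l m r, fun x y z => ?_⟩
  have : ∀ w, f (S.rel x w) * g (S.rel y w) * h (S.rel z w) = ∑ l, ∑ m, ∑ r, f l * g m * h r *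
      if S.rel x w = l ∧ S.rel y w = m ∧ S.rel z w = r then 1 else 0 := by
    intro w
    rw [Finset.sum_eq_single (S.rel x w), Finset.sum_eq_single (S.rel y w),
      Finset.sum_eq_single (S.rel z w)]
    · simp
    · intro j _ hj; simp [hj.symm]
    · simp
    · intro i _ hi; simp [hi.symm]
    · simp
    · intro i _ hi; simp [hi.symm]
    · simp
  simp only [tripleSum, this]
  rw [Finset.sum_comm]
  refine Finset.sum_congr rfl fun i _ => ?_
  rw [Finset.sum_comm]
  refine Finset.sum_congr rfl fun j _ => ?_
  rw [Finset.sum_comm]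
  refine Finset.sum_congr rfl fun k _ => ?_
  rw [← Finset.mul_sum, Finset.sum_boole, hp _ _ _ i j k x y z rfl rfl rfl]

theorem isTriplyRegular_of_dependsOnRel
    (H : ∀ f g h, S.DependsOnRel (S.tripleSum f g h)) : S.IsTriplyRegular := by
  intro i j k l m r
  obtain ⟨φ, hφ⟩ := H (Pi.single l 1) (Pi.single m 1) (Pi.single r 1)
  -- The real number `φ i j k` is known to be a count only when some triple realises `i, j, k`; the
  -- floor supplies a natural number in every case.
  refine ⟨⌊φ i j k⌋₊, fun x y z hi hj hk => ?_⟩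
  rw [← hi, ← hj, ← hk, ← hφ]
  have : S.tripleSum (Pi.single l 1) (Pi.single m 1) (Pi.single r 1) x y z =
      (Finset.univ.filter fun w => S.rel x w = l ∧ S.rel y w = m ∧ S.rel z w = r).card := by
    rw [← Finset.sum_boole, tripleSum]
    refine Finset.sum_congr rfl fun w _ => ?_
    simp only [Pi.single_apply, ← ite_and, ite_mul, one_mul, zero_mul]
    congr 1
    exact propext (by tauto)
  rw [this, Nat.floor_natCast]

namespace IsLinkedSimplices

variable {M : X → X → ℝ} {θ : Fin 4 → ℝ} {v n : ℝ}

theorem thirdMoment_eq_tripleSum (H : S.IsLinkedSimplices M θ v n) :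
    thirdMoment M = S.tripleSum θ θ θ := by
  funext x y z
  simp only [thirdMoment, tripleSum, H.apply_eq]

theorem dependsOnRel_fibreFun_theta_theta (H : S.IsLinkedSimplices M θ v n) :
    S.DependsOnRel (S.tripleSum fibreFun θ θ) := by
  refine ⟨fun _ j _ => v * θ j, fun x y z => ?_⟩
  beta_reduce
  rw [← H.apply_eq, ← H.sum_fibre_mul_mul x]
  simp only [H.apply_eq, tripleSum, mul_assoc]
  rfl

/-- Fibres of `x` and `y` either coincide or are disjoint, so the sum collapses to one governed by
intersection numbers. -/
theorem dependsOnRel_fibreFun_fibreFun (H : S.IsLinkedSimplices M θ v n) (f : Fin 4 → ℝ) :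
    S.DependsOnRel (S.tripleSum fibreFun fibreFun f) := by
  obtain ⟨φ, hφ⟩ := S.exists_sum_mul_eq fibreFun f
  refine ⟨fun i _ k => fibreFun i * φ k, fun x y z => ?_⟩
  beta_reduce
  rw [S.rel_symm z x, ← hφ, Finset.mul_sum]
  refine Finset.sum_congr rfl fun w _ => ?_
  change S.fibre x w * S.fibre y w * _ = S.fibre x y * (S.fibre x w * _)
  have h' := fibre_mul_fibre H.equivalence x w y
  rw [S.fibre_symm w y] at h'
  rw [h']
  ring

/-- By trilinearity and symmetry only triples drawn from `θ` and `fibreFun` matter, and any of these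
containing `fibreFun` is already settled. -/
theorem dependsOnRel_of_theta (H : S.IsLinkedSimplices M θ v n)
    (hT : S.DependsOnRel (S.tripleSum θ θ θ)) (f g h : Fin 4 → ℝ) :
    S.DependsOnRel (S.tripleSum f g h) := by
  have hθ : θ 1 ≠ θ 3 := fun e => absurd (H.injective e) (by decide)
  have hκκ := H.dependsOnRel_fibreFun_fibreFun
  have hθθ : ∀ h, S.DependsOnRel (S.tripleSum h θ θ) := fun h =>
    relFun_induction (p := fun h => S.DependsOnRel (S.tripleSum h θ θ)) hθ
      (fun _ _ => .add_left) (fun c _ => .smul_left c) (S.dependsOnRel_one _ _)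
      (S.dependsOnRel_single_zero _ _) hT H.dependsOnRel_fibreFun_theta_theta h
  have hθκ : ∀ h, S.DependsOnRel (S.tripleSum h θ fibreFun) := fun h =>
    relFun_induction (p := fun h => S.DependsOnRel (S.tripleSum h θ fibreFun)) hθ
      (fun _ _ => .add_left) (fun c _ => .smul_left c) (S.dependsOnRel_one _ _)
      (S.dependsOnRel_single_zero _ _) (hθθ _).swap_left.swap_right (hκκ _).swap_right h
  have hfθ : ∀ f h, S.DependsOnRel (S.tripleSum f θ h) := fun f h =>
    .swap_right <| .swap_left <|
    relFun_induction (p := fun h => S.DependsOnRel (S.tripleSum h f θ)) hθ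
      (fun _ _ => .add_left) (fun c _ => .smul_left c) (S.dependsOnRel_one _ _)
      (S.dependsOnRel_single_zero _ _) (hθθ _).swap_left (hθκ _).swap_right.swap_left h
  have hfκ : ∀ f h, S.DependsOnRel (S.tripleSum f fibreFun h) := fun f h =>
    relFun_induction (p := fun f => S.DependsOnRel (S.tripleSum f fibreFun h)) hθ
      (fun _ _ => .add_left) (fun c _ => .smul_left c) (S.dependsOnRel_one _ _)
      (S.dependsOnRel_single_zero _ _) (hfθ _ _).swap_left (hκκ _) f
  exact .swap_left <| relFun_induction (p := fun g => S.DependsOnRel (S.tripleSum g f h)) hθ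
      (fun _ _ => .add_left) (fun c _ => .smul_left c) (S.dependsOnRel_one _ _)
      (S.dependsOnRel_single_zero _ _) (hfθ _ _).swap_left (hfκ _ _).swap_left g

theorem isTriplyRegular_iff [DecidableEq X] (H : S.IsLinkedSimplices M θ v n) :
    S.IsTriplyRegular ↔ momentRatio θ v n = 0 := by
  constructor
  · intro hS
    apply H.momentRatio_eq_zero
    rw [H.thirdMoment_eq_tripleSum]
    exact hS.dependsOnRel θ θ θ
  · intro hγ
    apply isTriplyRegular_of_dependsOnRel
    apply H.dependsOnRel_of_theta
    refine ⟨fun _ _ _ => 0, fun x y z => ?_⟩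
    rw [← H.thirdMoment_eq_tripleSum, H.thirdMoment_eq_zero hγ]

end IsLinkedSimplices

end TripleRegularity

end AssocScheme

theorem theorem2p1 {X : Type*} [Fintype X] [DecidableEq X] (S : AssocScheme X 3)
    (E : Fin 4 → Matrix X X ℝ) (hQ : S.IsQPolynomial E)
    (hanti : AssocScheme.IsQAntipodal E) (hrel : S.IsQAntipodalRelation E {0, 2}) :
    S.IsTriplyRegular ↔ AssocScheme.aStar E 1 = 0 := by
  obtain ⟨θ, v, H⟩ := hQ.exists_isLinkedSimplices hanti hrel
  have : Nonempty X := ⟨(S.rel_nonempty 0).choose⟩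
  rw [H.isTriplyRegular_iff, ← H.sum_thirdMoment_diag_eq_zero_iff, AssocScheme.aStar,
    hQ.1.krein_eq]
  have hX := S.card_ne_zero
  -- The right side is, up to nonzero factors, the trace formula for `q₁₁¹ = a₁*`.
  have : ∑ x, AssocScheme.thirdMoment (fun x y => Fintype.card X * E 1 x y) x x x =
      (Fintype.card X : ℝ) ^ 3 * ∑ x, ∑ y, E 1 x y * E 1 x y * E 1 x y := by
    simp only [AssocScheme.thirdMoment, Finset.mul_sum]
    exact Finset.sum_congr rfl fun x _ => Finset.sum_congr rfl fun y _ => by ring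
  rw [this]
  simp [hX, hQ.1.trace_ne_zero 1]
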